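/- Let $d\ge 1$, $\omega>0$ and $\lambda_1,\dots,\lambda_d>0$. Let $\mathbb{T}^d=(-\pi,\pi]^d$ be the torus with Lebesgue measure; a function on $\mathbb{T}^d$ is identified with its extension to $\mathbb{R}^d$ that is $2\pi$-periodic in each coordinate, and $C^{n}(\mathbb{T}^d)$ denotes the complex-valued functions whose extension is $C^n$ on $\mathbb{R}^d$. For $t\in\mathbb{R}$, $x\in\mathbb{Z}^d$ and $k\in\mathbb{R}^d$ set $$\gamma(k)=\Big(\omega^2+4\sum_{j=1}^d\lambda_j\sin^2(k_j/2)\Big)^{1/2},\qquad \phi_{t,x}(k)=k\cdot x-2t\,\gamma(k).$$ Then there is a number $C$, depending only on $d$, $\omega$ and $\lambda_1,\dots,\lambda_d$, such that for every $\eta\in C^{d+3}(\mathbb{T}^d)$, every $x\in\mathbb{Z}^d$ and every real $t$ with $|t|\ge 1$, $$\left|\int_{\mathbb{T}^d}e^{i\phi_{t,x}(k)}\,\eta(k)\,dk\right|\le C\left(\frac{\|\eta\|_\infty}{|t|^{d/2}}+\sup_{|\beta|\le d+3}\|\partial^\beta\eta\|_\infty\cdot\frac{(3+\|x\|_1)^{d+3}}{|t|^{(d+1)/2}}\right),$$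 where $\|x\|_1=\sum_{j=1}^d|x_j|$, $\|\cdot\|_\infty$ is the norm of $L^\infty(\mathbb{T}^d)$, and the supremum is over all multi-indices $\beta$ of order at most $d+3$. -/

import Mathlib

noncomputable section

namespace HarmonicLattice

/-- The torus `𝕋^d = (-π, π]^d`, carrying Lebesgue measure. -/
def torus (d : ℕ) : Set (Fin d → ℝ) :=
  Set.univ.pi fun _ => Set.Ioc (-Real.pi) Real.pi

/-- The function `γ(k) = √(ω² + 4 ∑ⱼ λⱼ sin²(kⱼ/2))`. -/
def gam {d : ℕ} (ω : ℝ) (lam : Fin d → ℝ) (k : Fin d → ℝ) : ℝ :=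
  Real.sqrt (ω ^ 2 + 4 * ∑ j, lam j * Real.sin (k j / 2) ^ 2)

/-- The phase `φ_{t,x}(k) = k · x - 2 t γ(k)`. -/
def phase {d : ℕ} (ω : ℝ) (lam : Fin d → ℝ) (t : ℝ) (x : Fin d → ℤ) (k : Fin d → ℝ) : ℝ :=
  ∑ j, k j * (x j : ℝ) - 2 * t * gam ω lam k

/-- `η ∈ C^n(𝕋^d)`: a complex-valued function on the torus is identified with its lift to `ℝ^d`,
which is `2π`-periodic in each coordinate; it is `C^n` when the lift is. -/
def IsTorusCk {d : ℕ} (n : ℕ) (η : (Fin d → ℝ) → ℂ) : Prop :=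
  ContDiff ℝ n η ∧ ∀ (j : Fin d) (k : Fin d → ℝ), η (k + Pi.single j (2 * Real.pi)) = η k

/-- The partial derivative `∂f/∂k_j`. -/
def pderiv {d : ℕ} (j : Fin d) (f : (Fin d → ℝ) → ℂ) : (Fin d → ℝ) → ℂ :=
  fun k => lineDeriv ℝ f k (Pi.single j 1)

/-- The order `|β|` of a multi-index. -/
def order {d : ℕ} (β : Fin d → ℕ) : ℕ := ∑ j, β j

/-- The derivative `∂^β f = ∂_1^{β_1} ⋯ ∂_d^{β_d} f` for a multi-index `β`. -/
def mderiv {d : ℕ} (β : Fin d → ℕ) (f : (Fin d → ℝ) → ℂ) : (Fin d → ℝ) → ℂ :=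
  (List.finRange d).foldr (fun j g => (pderiv j)^[β j] g) f

/-- The norm of `L^∞(𝕋^d)`. -/
def supNorm {d : ℕ} (f : (Fin d → ℝ) → ℂ) : ℝ :=
  (MeasureTheory.eLpNorm f ⊤ (MeasureTheory.volume.restrict (torus d))).toReal

/-- `sup_{|β| ≤ N} ‖∂^β f‖_∞`, a supremum over a finite set of multi-indices. -/
def derivSupNorm {d : ℕ} (N : ℕ) (f : (Fin d → ℝ) → ℂ) : ℝ :=
  ⨆ β : {β : Fin d → ℕ // order β ≤ N}, supNorm (mderiv β.1 f)

/-- `‖x‖₁ = ∑ⱼ |xⱼ|` on `ℤ^d`. -/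
def latticeNorm {d : ℕ} (x : Fin d → ℤ) : ℝ := ∑ j, |(x j : ℝ)|

end HarmonicLattice

end

/-!
Write `T = |t|` and let `V = ∑ⱼ sin(kⱼ) ∂ⱼ` be the sine field. Then `V γ = Q / γ` with
`Q = ∑ⱼ λⱼ sin² kⱼ`, so `V` is a field along which the phase is monotone and which vanishes at
the (nondegenerate) critical points of `γ` only. The plane wave `exp(i k·x)` is regarded as part of
the amplitude `b = exp(i k·x) η`, which leaves the oscillating factor `E = exp(-2 i t γ)`.

Instead of cutting out the critical points, the proof uses the weight `w = 1 / (1 + T Q)`. From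
`(1 + T Q) E = E + (i σ / 2) γ V E`, with `σ` the sign of `t`, an integration by parts turns
`∫ E wⁿ c b` into `∫ E wⁿ⁺¹ (c₁ b + c₂ V b)`: one more power of `w` for at most one derivative on `b`
(`exists_integral_osc_eq`). The coefficients stay in the algebra `Coef`, which is closed under `V`
and consists of functions bounded uniformly in `T ≥ 0`. There are no boundary terms, since `V` is
tangent to the faces of the box `[-π, π]^d`. After `d + 1` steps,
`|∫ E b| ≤ C ∑_{j ≤ d + 1} ∫ wᵈ⁺¹ |Vʲ b|` (`exists_norm_integral_osc_le`).

Three facts finish the proof. First, `∫ wᵈ ≤ C T^{-d/2}`, because `wᵈ` is at most a product of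
functions of one variable (`exists_integral_weight_pow_le`). Secondly, the term `j = 0` contains
`|b| = |η|` only. Thirdly, for `j ≥ 1`, `|Vʲ b|` is at most a constant times
`∑_l |sin k_l|` times the product of `(3 + ‖x‖₁)^{d+3}` and a bound for the derivatives of `η`
(`exists_norm_sinDeriv_iterate_le`), and `w |sin k_l| ≤ C T^{-1/2}`
(`exists_weight_mul_abs_sin_le`).
-/

noncomputable section

namespace HarmonicLattice

open MeasureTheory

variable {d : ℕ}

/-! ### The sine field and the regularizing weight -/

/-- The derivative `∑ⱼ sin(kⱼ) ∂ⱼ f` along the vector field with components `sin kⱼ`. The field is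
tangent to the faces of the box `[-π, π]^d` and vanishes exactly at the critical points of `γ`
in it. -/
def sinDeriv (f : (Fin d → ℝ) → ℂ) (k : Fin d → ℝ) : ℂ :=
  fderiv ℝ f k fun j => Real.sin (k j)

/-- The function `Q(k) = ∑ⱼ λⱼ sin² kⱼ`, which is `γ` times the derivative of `γ` along the sine
field. -/
def sinSq (lam : Fin d → ℝ) (k : Fin d → ℝ) : ℝ := ∑ j, lam j * Real.sin (k j) ^ 2

/-- The weight `w = 1 / (1 + t Q)`, concentrated at distance `t^{-1/2}` from the critical points. -/
def weight (lam : Fin d → ℝ) (t : ℝ) (k : Fin d → ℝ) : ℝ := (1 + t * sinSq lam k)⁻¹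

/-- The oscillating factor `exp(-2 i σ t γ)`; the sign `σ = ±1` allows `t` to be nonnegative. -/
def osc (ω : ℝ) (lam : Fin d → ℝ) (σ t : ℝ) (k : Fin d → ℝ) : ℂ :=
  Complex.exp (((-(2 * σ * t * gam ω lam k) : ℝ) : ℂ) * Complex.I)

section Basic

variable {ω : ℝ} {lam : Fin d → ℝ}

theorem sinSq_nonneg (hlam : ∀ j, 0 < lam j) (k : Fin d → ℝ) : 0 ≤ sinSq lam k :=
  Finset.sum_nonneg fun j _ => mul_nonneg (hlam j).le (sq_nonneg _)

theorem le_sinSq (hlam : ∀ j, 0 < lam j) (k : Fin d → ℝ) (l : Fin d) :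
    lam l * Real.sin (k l) ^ 2 ≤ sinSq lam k :=
  Finset.single_le_sum (f := fun j => lam j * Real.sin (k j) ^ 2)
    (fun j _ => mul_nonneg (hlam j).le (sq_nonneg _)) (Finset.mem_univ l)

theorem one_le_denom (hlam : ∀ j, 0 < lam j) {t : ℝ} (ht : 0 ≤ t) (k : Fin d → ℝ) :
    1 ≤ 1 + t * sinSq lam k := by
  have := mul_nonneg ht (sinSq_nonneg hlam k)
  linarith

theorem weight_pos (hlam : ∀ j, 0 < lam j) {t : ℝ} (ht : 0 ≤ t) (k : Fin d → ℝ) :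
    0 < weight lam t k :=
  inv_pos.2 (zero_lt_one.trans_le (one_le_denom hlam ht k))

theorem weight_le_one (hlam : ∀ j, 0 < lam j) {t : ℝ} (ht : 0 ≤ t) (k : Fin d → ℝ) :
    weight lam t k ≤ 1 :=
  inv_le_one_of_one_le₀ (one_le_denom hlam ht k)

theorem mul_sinSq_mul_weight (hlam : ∀ j, 0 < lam j) {t : ℝ} (ht : 0 ≤ t) (k : Fin d → ℝ) :
    t * sinSq lam k * weight lam t k = 1 - weight lam t k := by
  have := one_le_denom hlam ht k
  unfold weight
  field_simp
  ring

theorem radicand_pos (hω : 0 < ω) (hlam : ∀ j, 0 < lam j) (k : Fin d → ℝ) :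
    0 < ω ^ 2 + 4 * ∑ j, lam j * Real.sin (k j / 2) ^ 2 := by
  have : 0 ≤ ∑ j, lam j * Real.sin (k j / 2) ^ 2 :=
    Finset.sum_nonneg fun j _ => mul_nonneg (hlam j).le (sq_nonneg _)
  have := pow_pos hω 2
  linarith

theorem gam_pos (hω : 0 < ω) (hlam : ∀ j, 0 < lam j) (k : Fin d → ℝ) : 0 < gam ω lam k :=
  Real.sqrt_pos.2 (radicand_pos hω hlam k)

theorem le_gam (hlam : ∀ j, 0 < lam j) (k : Fin d → ℝ) : ω ≤ gam ω lam k := by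
  have : 0 ≤ ∑ j, lam j * Real.sin (k j / 2) ^ 2 :=
    Finset.sum_nonneg fun j _ => mul_nonneg (hlam j).le (sq_nonneg _)
  exact Real.le_sqrt_of_sq_le (by linarith)

theorem gam_le (hlam : ∀ j, 0 < lam j) (k : Fin d → ℝ) :
    gam ω lam k ≤ Real.sqrt (ω ^ 2 + 4 * ∑ j, lam j) := by
  refine Real.sqrt_le_sqrt ?_
  have : ∑ j, lam j * Real.sin (k j / 2) ^ 2 ≤ ∑ j, lam j :=
    Finset.sum_le_sum fun j _ => mul_le_of_le_one_right (hlam j).le (Real.sin_sq_le_one _)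
  linarith

theorem contDiff_sinSq : ContDiff ℝ ⊤ (sinSq lam) := by
  unfold sinSq
  fun_prop

theorem contDiff_weight (hlam : ∀ j, 0 < lam j) {t : ℝ} (ht : 0 ≤ t) :
    ContDiff ℝ ⊤ (weight lam t) := by
  unfold weight
  exact (contDiff_const.add (contDiff_const.mul contDiff_sinSq)).inv fun k =>
    (zero_lt_one.trans_le (one_le_denom hlam ht k)).ne'

theorem contDiff_gam (hω : 0 < ω) (hlam : ∀ j, 0 < lam j) : ContDiff ℝ ⊤ (gam ω lam) := by
  unfold gam
  exact ContDiff.sqrt (by fun_prop) fun k => (radicand_pos hω hlam k).ne'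

theorem contDiff_ofReal {n : WithTop ℕ∞} {f : (Fin d → ℝ) → ℝ} (hf : ContDiff ℝ n f) :
    ContDiff ℝ n fun k => (f k : ℂ) :=
  Complex.ofRealCLM.contDiff.comp hf

theorem contDiff_osc (hω : 0 < ω) (hlam : ∀ j, 0 < lam j) (σ t : ℝ) :
    ContDiff ℝ ⊤ (osc ω lam σ t) := by
  have h := contDiff_gam hω hlam
  unfold osc
  exact ((contDiff_ofReal (by fun_prop)).mul contDiff_const).cexp

theorem norm_osc (σ t : ℝ) (k : Fin d → ℝ) : ‖osc ω lam σ t k‖ = 1 :=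
  Complex.norm_exp_ofReal_mul_I _

end Basic

/-! ### Differentiation along the sine field -/

theorem sinDeriv_mul {f g : (Fin d → ℝ) → ℂ} {k : Fin d → ℝ} (hf : DifferentiableAt ℝ f k)
    (hg : DifferentiableAt ℝ g k) :
    sinDeriv (fun k => f k * g k) k = f k * sinDeriv g k + sinDeriv f k * g k := by
  unfold sinDeriv
  rw [fderiv_fun_mul hf hg]
  simp [mul_comm]

theorem sinDeriv_add {f g : (Fin d → ℝ) → ℂ} {k : Fin d → ℝ} (hf : DifferentiableAt ℝ f k)
    (hg : DifferentiableAt ℝ g k) :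
    sinDeriv (fun k => f k + g k) k = sinDeriv f k + sinDeriv g k := by
  unfold sinDeriv
  rw [fderiv_fun_add hf hg]
  simp

theorem sinDeriv_const (z : ℂ) (k : Fin d → ℝ) : sinDeriv (fun _ => z) k = 0 := by
  simp [sinDeriv]

/-- The derivative along the sine field is the derivative along a line in its direction. -/
theorem sinDeriv_eq_of_hasDerivAt {f : (Fin d → ℝ) → ℂ} {k : Fin d → ℝ} {D : ℂ}
    (hf : DifferentiableAt ℝ f k)
    (h : HasDerivAt (fun τ : ℝ => f (k + τ • fun j => Real.sin (k j))) D 0) :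
    sinDeriv f k = D := by
  rw [sinDeriv, ← hf.lineDeriv_eq_fderiv]
  exact h.deriv

theorem sinDeriv_ofReal {f : (Fin d → ℝ) → ℝ} {k : Fin d → ℝ} {D : ℝ}
    (hf : DifferentiableAt ℝ f k)
    (h : HasDerivAt (fun τ : ℝ => f (k + τ • fun j => Real.sin (k j))) D 0) :
    sinDeriv (fun k => (f k : ℂ)) k = D :=
  sinDeriv_eq_of_hasDerivAt (Complex.ofRealCLM.differentiableAt.comp k hf) h.ofReal_comp

theorem contDiff_sinDeriv {m : ℕ} {f : (Fin d → ℝ) → ℂ} (hf : ContDiff ℝ (m + 1 : ℕ) f) :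
    ContDiff ℝ m (sinDeriv f) := by
  unfold sinDeriv
  exact (hf.fderiv_right (m := m) (by norm_cast)).clm_apply (by fun_prop)

theorem sin_eq_sum_single (k : Fin d → ℝ) :
    (fun j => Real.sin (k j)) = ∑ j, Real.sin (k j) • Pi.single j (1 : ℝ) := by
  simpa using pi_eq_sum_univ' fun j => Real.sin (k j)

theorem hasDerivAt_sineLine (k : Fin d → ℝ) (l : Fin d) :
    HasDerivAt (fun τ : ℝ => (k + τ • fun j => Real.sin (k j)) l) (Real.sin (k l)) 0 := by
  simpa using ((hasDerivAt_id (0 : ℝ)).mul_const (Real.sin (k l))).const_add (k l)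

theorem hasDerivAt_sin_sq_line (k : Fin d → ℝ) (l : Fin d) :
    HasDerivAt (fun τ : ℝ => Real.sin ((k + τ • fun j => Real.sin (k j)) l) ^ 2)
      (2 * Real.sin (k l) ^ 2 * Real.cos (k l)) 0 := by
  refine ((hasDerivAt_sineLine k l).sin.pow 2).congr_deriv ?_
  simp
  ring

theorem hasDerivAt_sinSq_line (lam : Fin d → ℝ) (k : Fin d → ℝ) :
    HasDerivAt (fun τ : ℝ => sinSq lam (k + τ • fun j => Real.sin (k j)))
      (∑ j, lam j * (2 * Real.sin (k j) ^ 2 * Real.cos (k j))) 0 :=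
  HasDerivAt.fun_sum fun j _ => (hasDerivAt_sin_sq_line k j).const_mul (lam j)

theorem hasDerivAt_weight_line {lam : Fin d → ℝ} (hlam : ∀ j, 0 < lam j) {t : ℝ} (ht : 0 ≤ t)
    (k : Fin d → ℝ) :
    HasDerivAt (fun τ : ℝ => weight lam t (k + τ • fun j => Real.sin (k j)))
      (weight lam t k *
        -(∑ j, lam j * (2 * (t * weight lam t k * Real.sin (k j) ^ 2) * Real.cos (k j)))) 0 := by
  have hne := (zero_lt_one.trans_le (one_le_denom hlam ht k)).ne'
  have h := (((hasDerivAt_sinSq_line lam k).const_mul t).const_add 1).fun_inv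
    (by simpa using hne)
  refine h.congr_deriv ?_
  simp only [zero_smul, add_zero, weight]
  have : ∑ j, lam j * (2 * (t * (1 + t * sinSq lam k)⁻¹ * Real.sin (k j) ^ 2) * Real.cos (k j)) =
      t * (1 + t * sinSq lam k)⁻¹ * ∑ j, lam j * (2 * Real.sin (k j) ^ 2 * Real.cos (k j)) := by
    rw [Finset.mul_sum]
    exact Finset.sum_congr rfl fun j _ => by ring
  rw [this]
  generalize ∑ j, lam j * (2 * Real.sin (k j) ^ 2 * Real.cos (k j)) = S
  field_simp

theorem hasDerivAt_gam_line {ω : ℝ} {lam : Fin d → ℝ} (hω : 0 < ω) (hlam : ∀ j, 0 < lam j)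
    (k : Fin d → ℝ) :
    HasDerivAt (fun τ : ℝ => gam ω lam (k + τ • fun j => Real.sin (k j)))
      (sinSq lam k * (gam ω lam k)⁻¹) 0 := by
  have hs (j : Fin d) : HasDerivAt
      (fun τ : ℝ => Real.sin ((k + τ • fun j => Real.sin (k j)) j / 2) ^ 2)
      (Real.sin (k j) ^ 2 / 2) 0 := by
    refine (((hasDerivAt_sineLine k j).div_const 2).sin.pow 2).congr_deriv ?_
    have := Real.sin_two_mul (k j / 2)
    rw [mul_div_cancel₀ _ two_ne_zero] at this
    simp
    rw [this]
    ring
  have h := (((HasDerivAt.fun_sum fun j (_ : j ∈ Finset.univ) =>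
    (hs j).const_mul (lam j)).const_mul 4).const_add (ω ^ 2)).sqrt
    (by simpa using (radicand_pos hω hlam k).ne')
  refine h.congr_deriv ?_
  have hg : gam ω lam k ≠ 0 := (gam_pos hω hlam k).ne'
  simp only [zero_smul, add_zero]
  change _ / (2 * gam ω lam k) = _
  have : ∑ j, lam j * (Real.sin (k j) ^ 2 / 2) = sinSq lam k / 2 := by
    rw [sinSq, Finset.sum_div]
    exact Finset.sum_congr rfl fun j _ => by ring
  rw [this]
  field_simp
  ring

theorem sinDeriv_osc {ω : ℝ} {lam : Fin d → ℝ} (hω : 0 < ω) (hlam : ∀ j, 0 < lam j) (σ t : ℝ)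
    (k : Fin d → ℝ) :
    sinDeriv (osc ω lam σ t) k = osc ω lam σ t k *
      (((-(2 * σ * t * (sinSq lam k * (gam ω lam k)⁻¹)) : ℝ) : ℂ) * Complex.I) := by
  refine sinDeriv_eq_of_hasDerivAt ((contDiff_osc hω hlam σ t).differentiable (by simp) k) ?_
  have h := ((((hasDerivAt_gam_line hω hlam k).const_mul (2 * σ * t)).neg.ofReal_comp).mul_const
    Complex.I).cexp
  simpa [osc] using h

/-! ### The algebra of coefficients -/

/-- The coefficients that integration by parts along the sine field produces: the algebra, over
the constants, generated by `sin k_l`, `cos k_l`, `t w sin² k_l`, `γ` and `1/γ`. It depends on the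
parameter `t` only through functions that are bounded uniformly in `t ≥ 0`. -/
inductive Coef (ω : ℝ) (lam : Fin d → ℝ) : (ℝ → (Fin d → ℝ) → ℂ) → Prop
  | const (z : ℂ) : Coef ω lam fun _ _ => z
  | sin (l : Fin d) : Coef ω lam fun _ k => (Real.sin (k l) : ℂ)
  | cos (l : Fin d) : Coef ω lam fun _ k => (Real.cos (k l) : ℂ)
  | weighted (l : Fin d) : Coef ω lam fun t k => ((t * weight lam t k * Real.sin (k l) ^ 2 : ℝ) : ℂ)
  | gam : Coef ω lam fun _ k => (gam ω lam k : ℂ)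
  | gamInv : Coef ω lam fun _ k => (((HarmonicLattice.gam ω lam k)⁻¹ : ℝ) : ℂ)
  | add {f g : ℝ → (Fin d → ℝ) → ℂ} : Coef ω lam f → Coef ω lam g →
      Coef ω lam fun t k => f t k + g t k
  | mul {f g : ℝ → (Fin d → ℝ) → ℂ} : Coef ω lam f → Coef ω lam g →
      Coef ω lam fun t k => f t k * g t k

namespace Coef

variable {ω : ℝ} {lam : Fin d → ℝ}

theorem sum {ι : Type*} (s : Finset ι) {f : ι → ℝ → (Fin d → ℝ) → ℂ}
    (h : ∀ i ∈ s, Coef ω lam (f i)) : Coef ω lam fun t k => ∑ i ∈ s, f i t k := by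
  classical
  induction s using Finset.induction_on with
  | empty => simpa using Coef.const 0
  | insert i s hi ih =>
    simp only [Finset.sum_insert hi]
    exact (h i (Finset.mem_insert_self i s)).add
      (ih fun j hj => h j (Finset.mem_insert_of_mem hj))

theorem contDiff (hω : 0 < ω) (hlam : ∀ j, 0 < lam j) {f : ℝ → (Fin d → ℝ) → ℂ}
    (hf : Coef ω lam f) {t : ℝ} (ht : 0 ≤ t) : ContDiff ℝ ⊤ (f t) := by
  have hw := contDiff_weight hlam ht
  have hg := contDiff_gam hω hlam
  induction hf with
  | const z => exact contDiff_const
  | sin l => exact contDiff_ofReal (by fun_prop)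
  | cos l => exact contDiff_ofReal (by fun_prop)
  | weighted l => exact contDiff_ofReal (by fun_prop)
  | gam => exact contDiff_ofReal hg
  | gamInv => exact contDiff_ofReal (hg.inv fun k => (gam_pos hω hlam k).ne')
  | add _ _ h₁ h₂ => exact h₁.add h₂
  | mul _ _ h₁ h₂ => exact h₁.mul h₂

theorem bounded (hω : 0 < ω) (hlam : ∀ j, 0 < lam j) {f : ℝ → (Fin d → ℝ) → ℂ}
    (hf : Coef ω lam f) : ∃ C, 0 ≤ C ∧ ∀ t, 0 ≤ t → ∀ k, ‖f t k‖ ≤ C := by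
  induction hf with
  | const z => exact ⟨‖z‖, norm_nonneg _, fun _ _ _ => le_rfl⟩
  | sin l => exact ⟨1, zero_le_one, fun _ _ k => by
      simpa only [Complex.norm_real, Real.norm_eq_abs] using Real.abs_sin_le_one _⟩
  | cos l => exact ⟨1, zero_le_one, fun _ _ k => by
      simpa only [Complex.norm_real, Real.norm_eq_abs] using Real.abs_cos_le_one _⟩
  | weighted l =>
    refine ⟨(lam l)⁻¹, (inv_pos.2 (hlam l)).le, fun t ht k => ?_⟩
    have hw := weight_pos hlam ht k
    rw [Complex.norm_real, Real.norm_of_nonneg (by positivity), ← mul_le_mul_iff_right₀ (hlam l),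
      mul_inv_cancel₀ (hlam l).ne']
    have h₁ := mul_sinSq_mul_weight hlam ht k
    have h₂ := mul_le_mul_of_nonneg_left (le_sinSq hlam k l) (mul_nonneg ht hw.le)
    nlinarith
  | gam => exact ⟨_, Real.sqrt_nonneg _, fun _ _ k => by
      rw [Complex.norm_real, Real.norm_of_nonneg (gam_pos hω hlam k).le]
      exact gam_le hlam k⟩
  | gamInv => exact ⟨ω⁻¹, (inv_pos.2 hω).le, fun _ _ k => by
      rw [Complex.norm_real, Real.norm_of_nonneg (inv_pos.2 (gam_pos hω hlam k)).le]
      exact inv_anti₀ hω (le_gam hlam k)⟩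
  | add _ _ h₁ h₂ =>
    obtain ⟨C₁, h₁, H₁⟩ := h₁
    obtain ⟨C₂, h₂, H₂⟩ := h₂
    exact ⟨C₁ + C₂, add_nonneg h₁ h₂, fun t ht k =>
      (norm_add_le _ _).trans (add_le_add (H₁ t ht k) (H₂ t ht k))⟩
  | mul _ _ h₁ h₂ =>
    obtain ⟨C₁, h₁, H₁⟩ := h₁
    obtain ⟨C₂, h₂, H₂⟩ := h₂
    exact ⟨C₁ * C₂, mul_nonneg h₁ h₂, fun t ht k => (norm_mul_le _ _).trans
      (mul_le_mul (H₁ t ht k) (H₂ t ht k) (norm_nonneg _) h₁)⟩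

/-- The logarithmic derivative of the weight along the sine field is a coefficient. -/
theorem logDeriv_weight : Coef ω lam fun t k =>
    ((-(∑ j, lam j * (2 * (t * weight lam t k * Real.sin (k j) ^ 2) * Real.cos (k j))) : ℝ) : ℂ) := by
  have h := (Coef.const (ω := ω) (lam := lam) (-1)).mul (Coef.sum Finset.univ fun j _ =>
    (Coef.const (lam j : ℂ)).mul (((Coef.const 2).mul (Coef.weighted j)).mul (Coef.cos j)))
  convert h using 3
  push_cast
  ring

theorem sinSq_mul_gamInv : Coef ω lam fun _ k =>
    ((sinSq lam k * (HarmonicLattice.gam ω lam k)⁻¹ : ℝ) : ℂ) := by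
  have h := (Coef.sum Finset.univ fun j _ => (Coef.const (ω := ω) (lam := lam) (lam j : ℂ)).mul
    ((Coef.sin j).mul (Coef.sin j))).mul Coef.gamInv
  convert h using 3
  simp only [sinSq]
  push_cast
  simp only [sq]

/-- The algebra of coefficients is stable under differentiation along the sine field. -/
theorem exists_sinDeriv (hω : 0 < ω) (hlam : ∀ j, 0 < lam j) {f : ℝ → (Fin d → ℝ) → ℂ}
    (hf : Coef ω lam f) : ∃ g, Coef ω lam g ∧ ∀ t, 0 ≤ t → ∀ k, sinDeriv (f t) k = g t k := by
  have hg := contDiff_gam hω hlam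
  induction hf with
  | const z => exact ⟨_, Coef.const 0, fun t _ k => sinDeriv_const z k⟩
  | sin l =>
    refine ⟨_, (Coef.cos l).mul (Coef.sin l), fun t _ k => ?_⟩
    rw [← Complex.ofReal_mul]
    exact sinDeriv_ofReal (by fun_prop) (by simpa using (hasDerivAt_sineLine k l).sin)
  | cos l =>
    refine ⟨_, (Coef.const (-1)).mul ((Coef.sin l).mul (Coef.sin l)), fun t _ k => ?_⟩
    rw [sinDeriv_ofReal (by fun_prop) (hasDerivAt_sineLine k l).cos]
    simp
  | weighted l =>
    refine ⟨_, (Coef.weighted l).mul (((Coef.const 2).mul (Coef.cos l)).add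
      Coef.logDeriv_weight), fun t ht k => ?_⟩
    have hw := contDiff_weight hlam ht
    have h := ((hasDerivAt_weight_line hlam ht k).const_mul t).mul (hasDerivAt_sin_sq_line k l)
    refine (sinDeriv_ofReal (ContDiff.differentiable (n := ⊤) (by fun_prop) (by simp) k) h).trans ?_
    simp only [zero_smul, add_zero]
    push_cast
    ring
  | gam =>
    exact ⟨_, Coef.sinSq_mul_gamInv, fun t _ k => sinDeriv_ofReal
      (hg.differentiable (by simp) k) (hasDerivAt_gam_line hω hlam k)⟩
  | gamInv =>
    refine ⟨_, (Coef.const (-1)).mul (Coef.sinSq_mul_gamInv.mul (Coef.gamInv.mul Coef.gamInv)),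
      fun t _ k => ?_⟩
    have hne := (gam_pos hω hlam k).ne'
    have h := (hasDerivAt_gam_line hω hlam k).fun_inv (by simpa using hne)
    refine (sinDeriv_ofReal ((hg.differentiable (by simp) k).inv hne) h).trans ?_
    simp only [zero_smul, add_zero]
    push_cast
    field_simp
  | add hf₁ hf₂ h₁ h₂ =>
    obtain ⟨g₁, h₁, H₁⟩ := h₁
    obtain ⟨g₂, h₂, H₂⟩ := h₂
    refine ⟨_, h₁.add h₂, fun t ht k => ?_⟩
    rw [sinDeriv_add ((hf₁.contDiff hω hlam ht).differentiable (by simp) k)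
      ((hf₂.contDiff hω hlam ht).differentiable (by simp) k), H₁ t ht, H₂ t ht]
  | mul hf₁ hf₂ h₁ h₂ =>
    obtain ⟨g₁, h₁, H₁⟩ := h₁
    obtain ⟨g₂, h₂, H₂⟩ := h₂
    refine ⟨_, (hf₁.mul h₂).add (h₁.mul hf₂), fun t ht k => ?_⟩
    rw [sinDeriv_mul ((hf₁.contDiff hω hlam ht).differentiable (by simp) k)
      ((hf₂.contDiff hω hlam ht).differentiable (by simp) k), H₁ t ht, H₂ t ht]

end Coef

/-! ### Integration by parts along the sine field -/

/-- The closed box `[-π, π]^d`, which agrees with the torus up to a null set. -/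
def box (d : ℕ) : Set (Fin d → ℝ) := Set.Icc (fun _ => -Real.pi) fun _ => Real.pi

theorem torus_ae_eq_box (d : ℕ) : torus d =ᵐ[volume] box d :=
  Measure.univ_pi_Ioc_ae_eq_Icc

theorem isCompact_box (d : ℕ) : IsCompact (box d) := isCompact_Icc

theorem integrableOn_box {E : Type*} [NormedAddCommGroup E] {f : (Fin d → ℝ) → E}
    (hf : Continuous f) : IntegrableOn f (box d) :=
  hf.continuousOn.integrableOn_compact (isCompact_box d)

/-- The divergence theorem for `F` times the sine field. There are no boundary terms, because the
field is tangent to the faces of the box. -/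
theorem integral_sinDeriv_add (hd : 1 ≤ d) {F : (Fin d → ℝ) → ℂ} (hF : ContDiff ℝ 1 F) :
    ∫ k in box d, (sinDeriv F k + (∑ j, (Real.cos (k j) : ℂ)) * F k) = 0 := by
  obtain ⟨n, rfl⟩ : ∃ n, d = n + 1 := ⟨d - 1, by omega⟩
  have hs (j : Fin (n + 1)) : ContDiff ℝ 1 fun k : Fin (n + 1) → ℝ => (Real.sin (k j) : ℂ) :=
    contDiff_ofReal (by fun_prop)
  have hG (j : Fin (n + 1)) : ContDiff ℝ 1 fun k => (Real.sin (k j) : ℂ) * F k := (hs j).mul hF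
  have hdiv (k : Fin (n + 1) → ℝ) :
      ∑ j, fderiv ℝ (fun k => (Real.sin (k j) : ℂ) * F k) k (Pi.single j 1) =
        sinDeriv F k + (∑ j, (Real.cos (k j) : ℂ)) * F k := by
    have hF' := hF.differentiable one_ne_zero k
    have hd (j : Fin (n + 1)) :
        fderiv ℝ (fun k : Fin (n + 1) → ℝ => (Real.sin (k j) : ℂ)) k (Pi.single j 1) =
          (Real.cos (k j) : ℂ) := by
      have h := Complex.ofRealCLM.hasFDerivAt.comp k (hasFDerivAt_apply (𝕜 := ℝ) j k).sin
      refine (congrArg (fun A => A (Pi.single j 1)) h.fderiv).trans ?_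
      simp
    rw [sinDeriv, sin_eq_sum_single k, map_sum, Finset.sum_mul, ← Finset.sum_add_distrib]
    refine Finset.sum_congr rfl fun j _ => ?_
    rw [fderiv_fun_mul ((hs j).differentiable one_ne_zero k) hF']
    simp [-Complex.ofReal_sin, -Complex.ofReal_cos, hd, mul_comm]
  simp_rw [← hdiv]
  rw [box, integral_divergence_of_hasFDerivAt_off_countable' (fun _ => -Real.pi)
    (fun _ => Real.pi) (fun _ => by linarith [Real.pi_pos])
    (fun j k => (Real.sin (k j) : ℂ) * F k)
    (fun j => fderiv ℝ fun k => (Real.sin (k j) : ℂ) * F k) ∅ Set.countable_empty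
    (fun j => (hG j).continuous.continuousOn)
    (fun k _ j => ((hG j).differentiable one_ne_zero k).hasFDerivAt)]
  · simp
  · refine integrableOn_box (continuous_finsetSum _ fun j _ => ?_)
    exact ((hG j).continuous_fderiv one_ne_zero).clm_apply continuous_const

section Iteration

variable {ω : ℝ} {lam : Fin d → ℝ}

theorem sinDeriv_weight_pow (hlam : ∀ j, 0 < lam j) {t : ℝ} (ht : 0 ≤ t) (n : ℕ)
    (k : Fin d → ℝ) :
    sinDeriv (fun k => ((weight lam t k ^ n : ℝ) : ℂ)) k = (weight lam t k ^ n : ℝ) * (n *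
      ((-(∑ j, lam j * (2 * (t * weight lam t k * Real.sin (k j) ^ 2) * Real.cos (k j))) : ℝ) :
        ℂ)) := by
  have hw := contDiff_weight hlam ht
  refine (sinDeriv_ofReal (ContDiff.differentiable (n := ⊤) (by fun_prop) (by simp) k)
    ((hasDerivAt_weight_line hlam ht k).pow n)).trans ?_
  rcases n with _ | n
  · simp
  · simp only [zero_smul, add_zero, Nat.add_sub_cancel]
    push_cast
    ring

/-- One integration by parts gains one power of the weight, at the price of one derivative along
the sine field. -/
theorem exists_integral_osc_eq (hd : 1 ≤ d) (hω : 0 < ω) (hlam : ∀ j, 0 < lam j) {σ : ℝ}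
    (hσ : σ ^ 2 = 1) (n : ℕ) {c : ℝ → (Fin d → ℝ) → ℂ} (hc : Coef ω lam c) :
    ∃ c₁ c₂, Coef ω lam c₁ ∧ Coef ω lam c₂ ∧ ∀ t, 0 ≤ t → ∀ b : (Fin d → ℝ) → ℂ,
      ContDiff ℝ 1 b →
      ∫ k in box d, osc ω lam σ t k * ((weight lam t k ^ n : ℝ) * (c t k * b k)) =
        (∫ k in box d, osc ω lam σ t k * ((weight lam t k ^ (n + 1) : ℝ) * (c₁ t k * b k))) +
        ∫ k in box d, osc ω lam σ t k *
          ((weight lam t k ^ (n + 1) : ℝ) * (c₂ t k * sinDeriv b k)) := by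
  obtain ⟨c', hc', Hc'⟩ := hc.exists_sinDeriv hω hlam
  have hdiv : Coef ω lam fun _ k => ∑ j, (Real.cos (k j) : ℂ) :=
    Coef.sum Finset.univ fun j _ => Coef.cos j
  -- The field `F = (iσ/2) γ wⁿ⁺¹ c b · osc` has main term `t Q wⁿ⁺¹ c b · osc` in its divergence,
  -- and `t Q wⁿ⁺¹ = wⁿ - wⁿ⁺¹`.
  obtain ⟨c₁, hc₁, Hc₁⟩ : ∃ c₁, Coef ω lam c₁ ∧ ∀ t k, c₁ t k = c t k +
      -(Complex.I * σ / 2) * (((sinSq lam k * (gam ω lam k)⁻¹ : ℝ) : ℂ) * c t k +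
        ((n + 1 : ℕ) : ℂ) * ((-(∑ j, lam j * (2 * (t * weight lam t k * Real.sin (k j) ^ 2) *
          Real.cos (k j))) : ℝ) : ℂ) * (gam ω lam k * c t k) + gam ω lam k * c' t k +
        (∑ j, (Real.cos (k j) : ℂ)) * (gam ω lam k * c t k)) :=
    ⟨_, hc.add ((Coef.const (-(Complex.I * σ / 2))).mul
      ((((Coef.sinSq_mul_gamInv.mul hc).add (((Coef.const ((n + 1 : ℕ) : ℂ)).mul
        Coef.logDeriv_weight).mul (Coef.gam.mul hc))).add (Coef.gam.mul hc')).add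
        (hdiv.mul (Coef.gam.mul hc)))), fun _ _ => rfl⟩
  obtain ⟨c₂, hc₂, Hc₂⟩ : ∃ c₂, Coef ω lam c₂ ∧ ∀ t k, c₂ t k =
      -(Complex.I * σ / 2) * (gam ω lam k * c t k) :=
    ⟨_, (Coef.const (-(Complex.I * σ / 2))).mul (Coef.gam.mul hc), fun _ _ => rfl⟩
  refine ⟨c₁, c₂, hc₁, hc₂, fun t ht b hb => ?_⟩
  have hosc := contDiff_osc hω hlam σ t
  have hw := contDiff_weight hlam ht
  have hwn (n : ℕ) : ContDiff ℝ ⊤ fun k => ((weight lam t k ^ n : ℝ) : ℂ) :=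
    contDiff_ofReal (by fun_prop)
  have hg := contDiff_ofReal (contDiff_gam hω hlam)
  have hct := hc.contDiff hω hlam ht
  have hb0 : Continuous b := hb.continuous
  have hVb : Continuous (sinDeriv b) := (contDiff_sinDeriv (m := 0) hb).continuous
  have hF : ContDiff ℝ 1 fun k => osc ω lam σ t k * ((Complex.I * σ / 2) *
      ((weight lam t k ^ (n + 1) : ℝ) * ((gam ω lam k : ℂ) * (c t k * b k)))) :=
    (hosc.of_le le_top).mul (contDiff_const.mul (((hwn (n + 1)).of_le le_top).mul
      ((hg.of_le le_top).mul ((hct.of_le le_top).mul hb))))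
  have hint {f : (Fin d → ℝ) → ℂ} (n : ℕ) (hf : Continuous f) : Integrable
      (fun k => osc ω lam σ t k * ((weight lam t k ^ n : ℝ) * f k)) (volume.restrict (box d)) :=
    integrableOn_box (hosc.continuous.mul ((hwn n).continuous.mul hf))
  have h₀ := hint n (f := fun k => c t k * b k) (hct.continuous.mul hb0)
  have h₁ := hint (n + 1) (f := fun k => c₁ t k * b k)
    ((hc₁.contDiff hω hlam ht).continuous.mul hb0)
  have h₂ := hint (n + 1) (f := fun k => c₂ t k * sinDeriv b k)
    ((hc₂.contDiff hω hlam ht).continuous.mul hVb)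
  rw [← integral_add h₁ h₂, ← sub_eq_zero, ← integral_sub h₀ (h₁.fun_add h₂),
    ← integral_sinDeriv_add hd hF]
  refine integral_congr_ae (Filter.Eventually.of_forall fun k => ?_)
  have dosc := hosc.differentiable (by simp) k
  have dw := (hwn (n + 1)).differentiable (by simp) k
  have dg := hg.differentiable (by simp) k
  have dc := hct.differentiable (by simp) k
  have db := hb.differentiable one_ne_zero k
  have hgd := sinDeriv_ofReal ((contDiff_gam hω hlam).differentiable (by simp) k)
    (hasDerivAt_gam_line hω hlam k)
  simp only [Hc₁, Hc₂]
  have d₁ := dc.fun_mul db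
  have d₂ := dg.fun_mul d₁
  have d₃ := dw.fun_mul d₂
  have dz : DifferentiableAt ℝ (fun _ : Fin d → ℝ => Complex.I * (σ : ℂ) / 2) k :=
    differentiableAt_const _
  rw [sinDeriv_mul dosc (dz.fun_mul d₃), sinDeriv_mul dz d₃, sinDeriv_mul dw d₂,
    sinDeriv_mul dg d₁, sinDeriv_mul dc db,
    sinDeriv_osc hω hlam, sinDeriv_weight_pow hlam ht, hgd, Hc' t ht, sinDeriv_const]
  have hγ : (gam ω lam k : ℂ) ≠ 0 := Complex.ofReal_ne_zero.2 (gam_pos hω hlam k).ne'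
  have hw1 : (weight lam t k : ℂ) ^ n = (weight lam t k : ℂ) ^ (n + 1) +
      t * sinSq lam k * (weight lam t k : ℂ) ^ (n + 1) := by
    have h := congrArg (fun r : ℝ => (r : ℂ)) (mul_sinSq_mul_weight hlam ht k)
    push_cast at h
    linear_combination -(weight lam t k : ℂ) ^ n * h
  have hσ' : (σ : ℂ) ^ 2 = 1 := by exact_mod_cast hσ
  generalize hS : (-(∑ j, lam j * (2 * (t * weight lam t k * Real.sin (k j) ^ 2) *
    Real.cos (k j))) : ℝ) = S
  push_cast
  rw [hw1]
  generalize (∑ j, Complex.cos (k j : ℂ)) = D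
  have hI := Complex.I_sq
  have hmain : ((gam ω lam k : ℂ))⁻¹ * gam ω lam k = 1 := inv_mul_cancel₀ hγ
  linear_combination (osc ω lam σ t k * (t * sinSq lam k * (weight lam t k : ℂ) ^ (n + 1) *
    (c t k * b k))) * (Complex.I ^ 2 * σ ^ 2 * hmain + hI * σ ^ 2 - hσ')

/-- Iterated integration by parts. -/
theorem exists_norm_integral_osc_le (hd : 1 ≤ d) (hω : 0 < ω) (hlam : ∀ j, 0 < lam j) {σ : ℝ}
    (hσ : σ ^ 2 = 1) (m : ℕ) : ∀ (n : ℕ) {c : ℝ → (Fin d → ℝ) → ℂ}, Coef ω lam c →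
    ∃ C, 0 ≤ C ∧ ∀ t, 0 ≤ t → ∀ b : (Fin d → ℝ) → ℂ, ContDiff ℝ m b →
      ‖∫ k in box d, osc ω lam σ t k * ((weight lam t k ^ n : ℝ) * (c t k * b k))‖ ≤
        C * ∑ j ∈ Finset.range (m + 1),
          ∫ k in box d, weight lam t k ^ (n + m) * ‖sinDeriv^[j] b k‖ := by
  induction m with
  | zero =>
    intro n c hc
    obtain ⟨C, hC, H⟩ := hc.bounded hω hlam
    refine ⟨C, hC, fun t ht b hb => ?_⟩
    have hw := (contDiff_weight hlam ht).continuous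
    simp only [zero_add, Finset.range_one, Finset.sum_singleton, add_zero, Function.iterate_zero,
      id_eq]
    rw [← integral_const_mul]
    refine norm_integral_le_of_norm_le (integrableOn_box
      (continuous_const.mul ((hw.pow n).mul hb.continuous.norm)))
      (Filter.Eventually.of_forall fun k => ?_)
    have hw0 := pow_nonneg (weight_pos hlam ht k).le n
    rw [norm_mul, norm_osc, one_mul, norm_mul, norm_mul, Complex.norm_real,
      Real.norm_of_nonneg hw0]
    calc weight lam t k ^ n * (‖c t k‖ * ‖b k‖)
        ≤ weight lam t k ^ n * (C * ‖b k‖) := by gcongr; exact H t ht k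
      _ = _ := by ring
  | succ m ih =>
    intro n c hc
    obtain ⟨c₁, c₂, hc₁, hc₂, H⟩ := exists_integral_osc_eq hd hω hlam hσ n hc
    obtain ⟨C₁, hC₁, H₁⟩ := ih (n + 1) hc₁
    obtain ⟨C₂, hC₂, H₂⟩ := ih (n + 1) hc₂
    refine ⟨C₁ + C₂, add_nonneg hC₁ hC₂, fun t ht b hb => ?_⟩
    have hnn (j : ℕ) : 0 ≤ ∫ k in box d, weight lam t k ^ (n + 1 + m) * ‖sinDeriv^[j] b k‖ :=
      integral_nonneg fun k => mul_nonneg (pow_nonneg (weight_pos hlam ht k).le _) (norm_nonneg _)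
    have h₁ := H₁ t ht b (hb.of_le (by norm_cast; omega))
    have h₂ := H₂ t ht (sinDeriv b) (contDiff_sinDeriv hb)
    simp only [← Function.iterate_succ_apply] at h₂
    rw [H t ht b (hb.of_le (by norm_cast; omega)), add_mul, show n + (m + 1) = n + 1 + m by ring]
    refine (norm_add_le _ _).trans (add_le_add (h₁.trans ?_) (h₂.trans ?_))
    · refine mul_le_mul_of_nonneg_left ?_ hC₁
      rw [Finset.sum_range_succ _ (m + 1)]
      exact le_add_of_nonneg_right (hnn _)
    · refine mul_le_mul_of_nonneg_left ?_ hC₂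
      rw [Finset.sum_range_succ' _ (m + 1)]
      exact le_add_of_nonneg_right (hnn _)

end Iteration

/-! ### The integral of the weight -/

theorem integrable_and_integral_inv_one_add_mul_sq {a : ℝ} (ha : 0 < a) (p : ℝ) :
    Integrable (fun x : ℝ => (1 + (a * (x - p)) ^ 2)⁻¹) ∧
      ∫ x : ℝ, (1 + (a * (x - p)) ^ 2)⁻¹ = Real.pi / a := by
  constructor
  · exact (integrable_inv_one_add_sq.comp_mul_left' ha.ne').comp_sub_right p
  · rw [integral_sub_right_eq_self (fun x : ℝ => (1 + (a * x) ^ 2)⁻¹) p,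
      Measure.integral_comp_mul_left (fun x : ℝ => (1 + x ^ 2)⁻¹) a, integral_univ_inv_one_add_sq,
      abs_of_pos (inv_pos.2 ha), smul_eq_mul]
    ring

/-- A consequence of Jordan's inequality at whichever of `-π`, `0`, `π` is nearest. -/
theorem inv_one_add_mul_sin_sq_le {μ : ℝ} (hμ : 0 < μ) {x : ℝ}
    (hx : x ∈ Set.Icc (-Real.pi) Real.pi) :
    (1 + μ * Real.sin x ^ 2)⁻¹ ≤ (1 + (2 / Real.pi * √μ * (x - 0)) ^ 2)⁻¹ +
      ((1 + (2 / Real.pi * √μ * (x - Real.pi)) ^ 2)⁻¹ +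
        (1 + (2 / Real.pi * √μ * (x - -Real.pi)) ^ 2)⁻¹) := by
  have hπ := Real.pi_pos
  have key {p : ℝ} (hp : |x - p| ≤ Real.pi / 2) (hs : |Real.sin (x - p)| = |Real.sin x|) :
      (1 + μ * Real.sin x ^ 2)⁻¹ ≤ (1 + (2 / Real.pi * √μ * (x - p)) ^ 2)⁻¹ := by
    have h := Real.mul_abs_le_abs_sin hp
    rw [hs] at h
    have h2 := mul_self_le_mul_self (by positivity) h
    refine inv_anti₀ (by positivity) ?_
    have e : (2 / Real.pi * √μ * (x - p)) ^ 2 = μ * (2 / Real.pi * |x - p| *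
        (2 / Real.pi * |x - p|)) := by
      rw [mul_pow, mul_pow, Real.sq_sqrt hμ.le, ← sq_abs (x - p)]
      ring
    rw [abs_mul_abs_self] at h2
    rw [e, sq (Real.sin x)]
    gcongr
  have n1 (p : ℝ) : 0 ≤ (1 + (2 / Real.pi * √μ * (x - p)) ^ 2)⁻¹ := by positivity
  have h0 := n1 0
  have h1 := n1 Real.pi
  have h2 := n1 (-Real.pi)
  rcases le_or_gt (Real.pi / 2) x with h | h
  · have := key (p := Real.pi) (abs_le.2 ⟨by linarith, by linarith [hx.2]⟩)
      (by rw [Real.sin_sub_pi, abs_neg])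
    linarith
  rcases le_or_gt (-(Real.pi / 2)) x with h' | h'
  · have := key (p := 0) (abs_le.2 ⟨by linarith, by linarith⟩) (by rw [sub_zero])
    linarith
  · have := key (p := -Real.pi) (abs_le.2 ⟨by linarith [hx.1], by linarith⟩)
      (by rw [sub_neg_eq_add, Real.sin_add_pi, abs_neg])
    linarith

theorem integral_inv_one_add_mul_sin_sq_le {μ : ℝ} (hμ : 0 < μ) :
    ∫ x in Set.Icc (-Real.pi) Real.pi, (1 + μ * Real.sin x ^ 2)⁻¹ ≤
      3 * Real.pi ^ 2 / 2 / √μ := by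
  have hπ := Real.pi_pos
  have ha : 0 < 2 / Real.pi * √μ := by positivity
  have hI (p : ℝ) := integrable_and_integral_inv_one_add_mul_sq ha p
  have hsum₂ := (hI Real.pi).1.fun_add (hI (-Real.pi)).1
  have hsum := (hI 0).1.fun_add hsum₂
  have hcont : Continuous fun x : ℝ => (1 + μ * Real.sin x ^ 2)⁻¹ :=
    Continuous.inv₀ (by fun_prop) fun x => by positivity
  calc ∫ x in Set.Icc (-Real.pi) Real.pi, (1 + μ * Real.sin x ^ 2)⁻¹
      ≤ ∫ x in Set.Icc (-Real.pi) Real.pi, ((1 + (2 / Real.pi * √μ * (x - 0)) ^ 2)⁻¹ +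
        ((1 + (2 / Real.pi * √μ * (x - Real.pi)) ^ 2)⁻¹ +
        (1 + (2 / Real.pi * √μ * (x - -Real.pi)) ^ 2)⁻¹)) :=
        setIntegral_mono_on hcont.continuousOn.integrableOn_Icc hsum.integrableOn
          measurableSet_Icc fun x hx => inv_one_add_mul_sin_sq_le hμ hx
    _ ≤ ∫ x, ((1 + (2 / Real.pi * √μ * (x - 0)) ^ 2)⁻¹ +
        ((1 + (2 / Real.pi * √μ * (x - Real.pi)) ^ 2)⁻¹ +
        (1 + (2 / Real.pi * √μ * (x - -Real.pi)) ^ 2)⁻¹)) :=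
        setIntegral_le_integral hsum (Filter.Eventually.of_forall fun x => by
          change (0 : ℝ) ≤ _
          positivity)
    _ = 3 * Real.pi ^ 2 / 2 / √μ := by
        rw [integral_add (hI 0).1 hsum₂,
          integral_add (hI Real.pi).1 (hI (-Real.pi)).1, (hI 0).2, (hI Real.pi).2,
          (hI (-Real.pi)).2]
        field_simp
        ring

/-- Each factor `w` of `wᵈ` is bounded using one term of `Q`, which separates the variables. -/
theorem weight_pow_le_prod {lam : Fin d → ℝ} (hlam : ∀ j, 0 < lam j) {t : ℝ} (ht : 0 ≤ t)
    (k : Fin d → ℝ) :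
    weight lam t k ^ d ≤ ∏ j, (1 + t * lam j * Real.sin (k j) ^ 2)⁻¹ := by
  have h : weight lam t k ^ d = ∏ _j : Fin d, weight lam t k := by simp
  rw [h]
  refine Finset.prod_le_prod (fun j _ => (weight_pos hlam ht k).le) fun j _ => ?_
  have hl := (hlam j).le
  refine inv_anti₀ (by positivity) ?_
  have := mul_le_mul_of_nonneg_left (le_sinSq hlam k j) ht
  linarith

theorem exists_integral_weight_pow_le {lam : Fin d → ℝ} (hlam : ∀ j, 0 < lam j) :
    ∃ C, 0 ≤ C ∧ ∀ t, 0 < t →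
      ∫ k in box d, weight lam t k ^ d ≤ C / t ^ ((d : ℝ) / 2) := by
  refine ⟨∏ j, 3 * Real.pi ^ 2 / 2 / √(lam j), by positivity, fun t ht => ?_⟩
  have hbox : (volume.restrict (box d) : Measure (Fin d → ℝ)) =
      Measure.pi fun _ => (volume : Measure ℝ).restrict (Set.Icc (-Real.pi) Real.pi) := by
    rw [box, ← Set.pi_univ_Icc, volume_pi, Measure.restrict_pi_pi]
  have hcont (j : Fin d) : Continuous fun x : ℝ => (1 + t * lam j * Real.sin x ^ 2)⁻¹ :=
    Continuous.inv₀ (by fun_prop) fun x => by have := hlam j; positivity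
  calc ∫ k in box d, weight lam t k ^ d
      ≤ ∫ k in box d, ∏ j, (1 + t * lam j * Real.sin (k j) ^ 2)⁻¹ := by
        refine integral_mono (integrableOn_box ((contDiff_weight hlam ht.le).continuous.pow d))
          (integrableOn_box ?_) (weight_pow_le_prod hlam ht.le)
        exact continuous_finsetProd _ fun j _ => (hcont j).comp (continuous_apply j)
    _ = ∏ j, ∫ x in Set.Icc (-Real.pi) Real.pi, (1 + t * lam j * Real.sin x ^ 2)⁻¹ := by
        rw [hbox, integral_fintype_prod_eq_prod
          (fun j x => (1 + t * lam j * Real.sin x ^ 2)⁻¹)]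
    _ ≤ ∏ j, 3 * Real.pi ^ 2 / 2 / √(t * lam j) :=
        Finset.prod_le_prod (fun j _ => integral_nonneg fun x => by
          have := hlam j
          change (0 : ℝ) ≤ _
          positivity) fun j _ => integral_inv_one_add_mul_sin_sq_le (mul_pos ht (hlam j))
    _ = (∏ j, 3 * Real.pi ^ 2 / 2 / √(lam j)) / t ^ ((d : ℝ) / 2) := by
        have h : t ^ ((d : ℝ) / 2) = ∏ _j : Fin d, √t := by
          rw [Finset.prod_const, Finset.card_univ, Fintype.card_fin, Real.sqrt_eq_rpow,
            ← Real.rpow_natCast, ← Real.rpow_mul ht.le]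
          congr 1
          ring
        rw [h, ← Finset.prod_div_distrib]
        refine Finset.prod_congr rfl fun j _ => ?_
        rw [Real.sqrt_mul ht.le, mul_comm (√t), div_div _ (√(lam j))]

theorem exists_weight_mul_abs_sin_le {lam : Fin d → ℝ} (hlam : ∀ j, 0 < lam j) :
    ∃ C, 0 ≤ C ∧ ∀ t, 0 < t → ∀ k,
      weight lam t k * ∑ j, |Real.sin (k j)| ≤ C / t ^ ((1 : ℝ) / 2) := by
  refine ⟨∑ j, (√(lam j))⁻¹, by positivity, fun t ht k => ?_⟩
  rw [Finset.mul_sum, Finset.sum_div, ← Real.sqrt_eq_rpow]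
  refine Finset.sum_le_sum fun j _ => ?_
  have hl := hlam j
  have h1 := one_le_denom hlam ht.le k
  have h2 := mul_le_mul_of_nonneg_left (le_sinSq hlam k j) ht.le
  have h3 : √t * √t = t := Real.mul_self_sqrt ht.le
  have h4 : √(lam j) * √(lam j) = lam j := Real.mul_self_sqrt hl.le
  have h5 := Real.sqrt_pos.2 ht
  have h6 := Real.sqrt_pos.2 hl
  have h7 : √(lam j) * √t * |Real.sin (k j)| ≤ 1 + t * sinSq lam k := by
    have e : (√(lam j) * √t * |Real.sin (k j)|) ^ 2 = t * (lam j * Real.sin (k j) ^ 2) := by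
      rw [mul_pow, mul_pow, sq_abs, Real.sq_sqrt hl.le, Real.sq_sqrt ht.le]
      ring
    nlinarith [sq_nonneg (√(lam j) * √t * |Real.sin (k j)| - 1)]
  have e : (√(lam j))⁻¹ / √t = 1 / (√(lam j) * √t) := by field_simp
  rw [e, weight, inv_mul_eq_div, div_le_div_iff₀ (by linarith) (by positivity)]
  linarith

/-! ### Partial derivatives -/

theorem pderiv_apply {f : (Fin d → ℝ) → ℂ} {k : Fin d → ℝ} (hf : DifferentiableAt ℝ f k)
    (j : Fin d) : pderiv j f k = fderiv ℝ f k (Pi.single j 1) :=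
  hf.lineDeriv_eq_fderiv

theorem pderiv_eq {m : ℕ} {f : (Fin d → ℝ) → ℂ} (hf : ContDiff ℝ (m + 1 : ℕ) f) (j : Fin d) :
    pderiv j f = fun k => fderiv ℝ f k (Pi.single j 1) :=
  funext fun k => pderiv_apply (hf.differentiable (by norm_cast) k) j

theorem contDiff_pderiv {m : ℕ} {f : (Fin d → ℝ) → ℂ} (hf : ContDiff ℝ (m + 1 : ℕ) f)
    (j : Fin d) : ContDiff ℝ m (pderiv j f) := by
  rw [pderiv_eq hf]
  exact (hf.fderiv_right (m := m) (by norm_cast)).clm_apply contDiff_const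

theorem pderiv_comm {f : (Fin d → ℝ) → ℂ} (hf : ContDiff ℝ (2 : ℕ) f) (i j : Fin d) :
    pderiv i (pderiv j f) = pderiv j (pderiv i f) := by
  have hd : Differentiable ℝ (fderiv ℝ f) :=
    (hf.fderiv_right (m := 1) (by norm_cast)).differentiable one_ne_zero
  have key (i j : Fin d) (k : Fin d → ℝ) : pderiv i (pderiv j f) k =
      fderiv ℝ (fderiv ℝ f) k (Pi.single i 1) (Pi.single j 1) := by
    rw [pderiv_apply ((contDiff_pderiv (m := 1) hf j).differentiable (by simp) k),
      pderiv_eq (m := 1) hf, fderiv_clm_apply (hd k) (differentiableAt_const _)]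
    simp
  funext k
  rw [key, key]
  exact hf.contDiffAt.isSymmSndFDerivAt (by simp) _ _

theorem contDiff_pderiv_iterate (n : ℕ) {m : ℕ} {f : (Fin d → ℝ) → ℂ}
    (hf : ContDiff ℝ (m + n : ℕ) f) (i : Fin d) : ContDiff ℝ m ((pderiv i)^[n] f) := by
  induction n generalizing f with
  | zero => exact hf
  | succ n ih => exact ih (contDiff_pderiv hf i)

theorem pderiv_iterate_comm (n : ℕ) {f : (Fin d → ℝ) → ℂ} (hf : ContDiff ℝ (n + 1 : ℕ) f)
    (i j : Fin d) : pderiv j ((pderiv i)^[n] f) = (pderiv i)^[n] (pderiv j f) := by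
  induction n generalizing f with
  | zero => rfl
  | succ n ih =>
    rw [Function.iterate_succ_apply, ih (contDiff_pderiv hf i), Function.iterate_succ_apply,
      pderiv_comm (hf.of_le (by norm_cast; omega))]

theorem contDiff_foldr_pderiv (β : Fin d → ℕ) (L : List (Fin d)) {m : ℕ} {f : (Fin d → ℝ) → ℂ}
    (hf : ContDiff ℝ (m + (L.map β).sum : ℕ) f) :
    ContDiff ℝ m (L.foldr (fun j g => (pderiv j)^[β j] g) f) := by
  induction L generalizing m with
  | nil => simpa using hf
  | cons l L ih =>
    refine contDiff_pderiv_iterate _ (ih (m := m + β l) ?_) l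
    simpa [add_assoc] using hf

theorem pderiv_foldr_pderiv (β : Fin d → ℕ) (j : Fin d) (L : List (Fin d)) (hL : L.Nodup)
    (hj : j ∈ L) {f : (Fin d → ℝ) → ℂ} (hf : ContDiff ℝ (1 + (L.map β).sum : ℕ) f) :
    pderiv j (L.foldr (fun i g => (pderiv i)^[β i] g) f) =
      L.foldr (fun i g => (pderiv i)^[(β + Pi.single j 1 : Fin d → ℕ) i] g) f := by
  induction L with
  | nil => simp at hj
  | cons l L ih =>
    obtain ⟨hl, hL⟩ := List.nodup_cons.1 hL
    rw [List.foldr_cons, List.foldr_cons]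
    rcases List.mem_cons.1 hj with rfl | hj
    · have : L.foldr (fun i g => (pderiv i)^[(β + Pi.single j 1 : Fin d → ℕ) i] g) f =
          L.foldr (fun i g => (pderiv i)^[β i] g) f := by
        refine List.foldr_ext _ _ _ fun a ha g => ?_
        have : a ≠ j := fun h => hl (h ▸ ha)
        simp [this]
      rw [this, Pi.add_apply, Pi.single_eq_same, Function.iterate_succ_apply']
    · have hne : l ≠ j := fun h => hl (h ▸ hj)
      rw [pderiv_iterate_comm, ih hL hj (hf.of_le ?_), Pi.add_apply, Pi.single_eq_of_ne hne,
        add_zero]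
      · norm_cast
        simp
      · refine contDiff_foldr_pderiv β L ?_
        rwa [List.map_cons, List.sum_cons, ← add_assoc, add_comm 1] at hf

theorem contDiff_mderiv {β : Fin d → ℕ} {m : ℕ} {f : (Fin d → ℝ) → ℂ}
    (hf : ContDiff ℝ (m + order β : ℕ) f) : ContDiff ℝ m (mderiv β f) :=
  contDiff_foldr_pderiv β _ (by rwa [order, Fin.sum_univ_def] at hf)

theorem pderiv_mderiv {β : Fin d → ℕ} {f : (Fin d → ℝ) → ℂ}
    (hf : ContDiff ℝ (1 + order β : ℕ) f) (j : Fin d) :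
    pderiv j (mderiv β f) = mderiv (β + Pi.single j 1) f :=
  pderiv_foldr_pderiv β j _ (List.nodup_finRange d) (List.mem_finRange j)
    (by rwa [order, Fin.sum_univ_def] at hf)

theorem mderiv_zero (f : (Fin d → ℝ) → ℂ) : mderiv 0 f = f := by
  simp [mderiv]

theorem order_add_single (β : Fin d → ℕ) (j : Fin d) :
    order (β + Pi.single j 1) = order β + 1 := by
  simp [order, Finset.sum_add_distrib]

/-! ### Pointwise bounds on all derivatives up to a given order -/

/-- At the point `k`, all iterated partial derivatives of `f` of order at most `m`, in any order of
differentiation, are at most `R` in absolute value. -/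
def DerivBound : ℕ → ℝ → ((Fin d → ℝ) → ℂ) → (Fin d → ℝ) → Prop
  | 0, R, f, k => ‖f k‖ ≤ R
  | m + 1, R, f, k => ‖f k‖ ≤ R ∧ ∀ j, DerivBound m R (pderiv j f) k

namespace DerivBound

variable {m : ℕ} {R R' : ℝ} {f g : (Fin d → ℝ) → ℂ} {k : Fin d → ℝ}

theorem norm_le (h : DerivBound m R f k) : ‖f k‖ ≤ R := by
  cases m with
  | zero => exact h
  | succ m => exact h.1

theorem mono (hR : R ≤ R') (h : DerivBound m R f k) : DerivBound m R' f k := by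
  induction m generalizing f with
  | zero => exact le_trans h hR
  | succ m ih => exact ⟨h.1.trans hR, fun j => ih (h.2 j)⟩

theorem of_succ (h : DerivBound (m + 1) R f k) : DerivBound m R f k := by
  induction m generalizing f with
  | zero => exact h.1
  | succ m ih => exact ⟨h.1, fun j => ih (h.2 j)⟩

theorem zero (m : ℕ) (hR : 0 ≤ R) (k : Fin d → ℝ) : DerivBound m R (fun _ => 0) k := by
  induction m with
  | zero => simpa [DerivBound] using hR
  | succ m ih =>
    refine ⟨by simpa using hR, fun j => ?_⟩
    have : pderiv j (fun _ : Fin d → ℝ => (0 : ℂ)) = fun _ => 0 := by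
      funext k
      simp [pderiv, lineDeriv]
    rwa [this]

theorem add (hf : ContDiff ℝ m f) (hg : ContDiff ℝ m g) (h : DerivBound m R f k)
    (h' : DerivBound m R' g k) : DerivBound m (R + R') (fun k => f k + g k) k := by
  induction m generalizing f g with
  | zero => exact (norm_add_le _ _).trans (add_le_add h h')
  | succ m ih =>
    refine ⟨(norm_add_le _ _).trans (add_le_add h.1 h'.1), fun j => ?_⟩
    have e : pderiv j (fun k => f k + g k) = fun k => pderiv j f k + pderiv j g k := by
      funext k
      have hf' := hf.differentiable (by norm_cast) k
      have hg' := hg.differentiable (by norm_cast) k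
      rw [pderiv_apply (hf'.fun_add hg'), pderiv_apply hf', pderiv_apply hg',
        fderiv_fun_add hf' hg']
      rfl
    rw [e]
    exact ih (contDiff_pderiv hf j) (contDiff_pderiv hg j) (h.2 j) (h'.2 j)

theorem sum {ι : Type*} (s : Finset ι) {f : ι → (Fin d → ℝ) → ℂ} {R : ι → ℝ}
    (hf : ∀ i ∈ s, ContDiff ℝ m (f i)) (h : ∀ i ∈ s, DerivBound m (R i) (f i) k) :
    DerivBound m (∑ i ∈ s, R i) (fun k => ∑ i ∈ s, f i k) k := by
  classical
  induction s using Finset.induction_on with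
  | empty => simpa using zero m le_rfl k
  | insert i s hi ih =>
    simp only [Finset.sum_insert hi]
    have hs (j) (hj : j ∈ s) : j ∈ insert i s := Finset.mem_insert_of_mem hj
    exact add (hf i (Finset.mem_insert_self i s)) (ContDiff.sum fun j hj => hf j (hs j hj))
      (h i (Finset.mem_insert_self i s)) (ih (fun j hj => hf j (hs j hj)) fun j hj => h j (hs j hj))

theorem mul (hf : ContDiff ℝ m f) (hg : ContDiff ℝ m g) (h : DerivBound m R f k)
    (h' : DerivBound m R' g k) : DerivBound m (2 ^ m * (R * R')) (fun k => f k * g k) k := by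
  have hR : 0 ≤ R := (norm_nonneg _).trans h.norm_le
  have hR' : 0 ≤ R' := (norm_nonneg _).trans h'.norm_le
  induction m generalizing f g with
  | zero =>
    simp only [DerivBound, norm_mul, pow_zero, one_mul]
    exact mul_le_mul h h' (norm_nonneg _) hR
  | succ m ih =>
    refine ⟨?_, fun j => ?_⟩
    · rw [norm_mul]
      exact (mul_le_mul h.1 h'.1 (norm_nonneg _) hR).trans
        (le_mul_of_one_le_left (mul_nonneg hR hR') (one_le_pow₀ one_le_two))
    · have e : pderiv j (fun k => f k * g k) =
          fun k => f k * pderiv j g k + pderiv j f k * g k := by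
        funext k
        have hf' := hf.differentiable (by norm_cast) k
        have hg' := hg.differentiable (by norm_cast) k
        rw [pderiv_apply (hf'.fun_mul hg'), pderiv_apply hf', pderiv_apply hg',
          fderiv_fun_mul hf' hg']
        simp [mul_comm]
      have hfm : ContDiff ℝ m f := hf.of_le (by norm_cast; omega)
      have hgm : ContDiff ℝ m g := hg.of_le (by norm_cast; omega)
      have hdf := contDiff_pderiv hf j
      have hdg := contDiff_pderiv hg j
      rw [e, pow_succ, mul_two, add_mul]
      exact add (hfm.mul hdg) (hdf.mul hgm) (ih hfm hdg h.of_succ (h'.2 j))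
        (ih hdf hgm (h.2 j) h'.of_succ)

theorem const_mul (z : ℂ) (hf : ContDiff ℝ m f) (h : DerivBound m R f k) :
    DerivBound m (‖z‖ * R) (fun k => z * f k) k := by
  induction m generalizing f with
  | zero =>
    simp only [DerivBound, norm_mul]
    exact mul_le_mul_of_nonneg_left h (norm_nonneg z)
  | succ m ih =>
    refine ⟨?_, fun j => ?_⟩
    · rw [norm_mul]
      exact mul_le_mul_of_nonneg_left h.1 (norm_nonneg z)
    · have e : pderiv j (fun k => z * f k) = fun k => z * pderiv j f k := by
        funext k
        have hf' := hf.differentiable (by norm_cast) k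
        rw [pderiv_apply (hf'.const_mul z), pderiv_apply hf', fderiv_const_mul hf']
        simp
      rw [e]
      exact ih (contDiff_pderiv hf j) (h.2 j)

theorem sin_add (m : ℕ) (l : Fin d) (a : ℝ) (k : Fin d → ℝ) :
    DerivBound m 1 (fun k => (Real.sin (k l + a) : ℂ)) k := by
  have h1 (a : ℝ) (k : Fin d → ℝ) : ‖(Real.sin (k l + a) : ℂ)‖ ≤ 1 := by
    rw [Complex.norm_real]
    exact Real.abs_sin_le_one _
  induction m generalizing a with
  | zero => exact h1 a k
  | succ m ih =>
    refine ⟨h1 a k, fun j => ?_⟩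
    have hline (k : Fin d → ℝ) : HasDerivAt
        (fun τ : ℝ => (Real.sin ((k + τ • (Pi.single j 1 : Fin d → ℝ)) l + a) : ℂ))
        ((Real.cos (k l + a) * (Pi.single j 1 : Fin d → ℝ) l : ℝ) : ℂ) 0 := by
      have h := (((hasDerivAt_id (0 : ℝ)).mul_const ((Pi.single j 1 : Fin d → ℝ) l)).const_add
        (k l)).add_const a
      simpa using h.sin.ofReal_comp
    have e : pderiv j (fun k : Fin d → ℝ => (Real.sin (k l + a) : ℂ)) = fun k =>
        ((Real.cos (k l + a) * (Pi.single j 1 : Fin d → ℝ) l : ℝ) : ℂ) :=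
      funext fun k => (hline k).deriv
    rw [e]
    rcases eq_or_ne l j with rfl | hlj
    · simpa [Real.sin_add_pi_div_two, ← add_assoc] using ih (a + Real.pi / 2)
    · simpa [hlj] using zero m zero_le_one k

theorem sinDeriv (hf : ContDiff ℝ (m + 1 : ℕ) f) (h : DerivBound (m + 1) R f k) :
    DerivBound m (d * (2 ^ m * (1 * R))) (sinDeriv f) k := by
  have e : HarmonicLattice.sinDeriv f =
      fun k => ∑ j, (Real.sin (k j + 0) : ℂ) * pderiv j f k := by
    funext k
    rw [HarmonicLattice.sinDeriv, sin_eq_sum_single k, map_sum]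
    refine Finset.sum_congr rfl fun j _ => ?_
    rw [pderiv_apply (hf.differentiable (by norm_cast) k)]
    simp
  have hs (j : Fin d) : ContDiff ℝ m fun k : Fin d → ℝ => (Real.sin (k j + 0) : ℂ) :=
    contDiff_ofReal (by fun_prop)
  rw [e]
  have := sum (m := m) (k := k) Finset.univ (R := fun _ => 2 ^ m * (1 * R))
    (fun j _ => (hs j).mul (contDiff_pderiv hf j))
    (fun j _ => mul (hs j) (contDiff_pderiv hf j) (sin_add m j 0 k) (h.2 j))
  simpa using this

end DerivBound

theorem contDiff_sinDeriv_iterate (j : ℕ) {m : ℕ} {f : (Fin d → ℝ) → ℂ}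
    (hf : ContDiff ℝ (m + j : ℕ) f) : ContDiff ℝ m (sinDeriv^[j] f) := by
  induction j generalizing f with
  | zero => exact hf
  | succ j ih => exact ih (contDiff_sinDeriv hf)

theorem exists_derivBound_sinDeriv_iterate (d j m : ℕ) :
    ∃ C : ℝ, 0 ≤ C ∧ ∀ (f : (Fin d → ℝ) → ℂ) (k : Fin d → ℝ) (R : ℝ),
      ContDiff ℝ (m + j : ℕ) f → DerivBound (m + j) R f k →
        DerivBound m (C * R) (sinDeriv^[j] f) k := by
  induction j generalizing m with
  | zero => exact ⟨1, zero_le_one, fun f k R _ h => by simpa using h⟩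
  | succ j ih =>
    obtain ⟨C, hC, H⟩ := ih (m + 1)
    refine ⟨d * (2 ^ m * C), by positivity, fun f k R hf h => ?_⟩
    rw [show m + (j + 1) = m + 1 + j by ring] at hf h
    rw [Function.iterate_succ_apply']
    have := (H f k R hf h).sinDeriv (contDiff_sinDeriv_iterate j hf)
    rwa [one_mul, ← mul_assoc (2 ^ m) C, ← mul_assoc (d : ℝ)] at this

/-- A derivative of positive order along the sine field vanishes where the field does. -/
theorem exists_norm_sinDeriv_iterate_le (d j : ℕ) :
    ∃ C : ℝ, 0 ≤ C ∧ ∀ (f : (Fin d → ℝ) → ℂ) (k : Fin d → ℝ) (R : ℝ),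
      ContDiff ℝ (j + 1 : ℕ) f → DerivBound (j + 1) R f k →
        ‖sinDeriv^[j + 1] f k‖ ≤ (∑ l, |Real.sin (k l)|) * (C * R) := by
  obtain ⟨C, hC, H⟩ := exists_derivBound_sinDeriv_iterate d j 1
  refine ⟨C, hC, fun f k R hf h => ?_⟩
  rw [add_comm j] at hf h
  have hb := (H f k R hf h).2
  have hd := (contDiff_sinDeriv_iterate j hf).differentiable (by simp) k
  rw [Function.iterate_succ_apply', sinDeriv, sin_eq_sum_single k, map_sum, Finset.sum_mul]
  refine norm_sum_le_of_le _ fun l _ => ?_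
  rw [map_smul, norm_smul, Real.norm_eq_abs, ← pderiv_apply hd]
  exact mul_le_mul_of_nonneg_left (hb l) (abs_nonneg _)

theorem derivBound_mderiv {N : ℕ} {R : ℝ} {η : (Fin d → ℝ) → ℂ} {k : Fin d → ℝ}
    (hη : ContDiff ℝ N η) (h : ∀ β, order β ≤ N → ‖mderiv β η k‖ ≤ R) (m : ℕ) (α : Fin d → ℕ)
    (hα : order α + m ≤ N) : DerivBound m R (mderiv α η) k := by
  induction m generalizing α with
  | zero => exact h α hα
  | succ m ih =>
    refine ⟨h α (by omega), fun j => ?_⟩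
    rw [pderiv_mderiv (hη.of_le (by norm_cast; omega))]
    exact ih _ (by rw [order_add_single]; omega)

/-! ### The plane wave -/

/-- The plane wave `exp(i k·x)`. -/
def planeWave (x : Fin d → ℤ) (k : Fin d → ℝ) : ℂ :=
  Complex.exp (((∑ j, k j * (x j : ℝ) : ℝ) : ℂ) * Complex.I)

theorem contDiff_planeWave {n : WithTop ℕ∞} (x : Fin d → ℤ) : ContDiff ℝ n (planeWave x) := by
  unfold planeWave
  exact ((contDiff_ofReal (by fun_prop)).mul contDiff_const).cexp

theorem norm_planeWave (x : Fin d → ℤ) (k : Fin d → ℝ) : ‖planeWave x k‖ = 1 :=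
  Complex.norm_exp_ofReal_mul_I _

theorem pderiv_planeWave (x : Fin d → ℤ) (j : Fin d) :
    pderiv j (planeWave x) = fun k => (x j : ℂ) * Complex.I * planeWave x k := by
  funext k
  have h1 (l : Fin d) : HasDerivAt
      (fun τ : ℝ => (k + τ • (Pi.single j 1 : Fin d → ℝ)) l * (x l : ℝ))
      ((Pi.single j 1 : Fin d → ℝ) l * (x l : ℝ)) 0 := by
    simpa using (((hasDerivAt_id (0 : ℝ)).mul_const ((Pi.single j 1 : Fin d → ℝ) l)).const_add
      (k l)).mul_const (x l : ℝ)
  have h2 := (((HasDerivAt.fun_sum fun l (_ : l ∈ Finset.univ) => h1 l).ofReal_comp).mul_const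
    Complex.I).cexp
  have h3 : ∑ l, (Pi.single j 1 : Fin d → ℝ) l * (x l : ℝ) = x j := by
    rw [Finset.sum_eq_single j]
    · simp
    · intro l _ hl
      simp [hl]
    · simp
  refine h2.deriv.trans ?_
  rw [h3, mul_comm]
  simp [planeWave]

theorem derivBound_planeWave (x : Fin d → ℤ) {X : ℝ} (h1 : 1 ≤ X) (hX : ∀ j, |(x j : ℝ)| ≤ X)
    (m : ℕ) (k : Fin d → ℝ) : DerivBound m (X ^ m) (planeWave x) k := by
  induction m with
  | zero => exact (norm_planeWave x k).trans_le (by simp)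
  | succ m ih =>
    refine ⟨(norm_planeWave x k).trans_le (one_le_pow₀ h1), fun j => ?_⟩
    rw [pderiv_planeWave]
    refine (ih.const_mul _ (contDiff_planeWave x)).mono ?_
    rw [norm_mul, Complex.norm_I, mul_one, ← Complex.ofReal_intCast, Complex.norm_real, pow_succ',
      Real.norm_eq_abs]
    exact mul_le_mul_of_nonneg_right (hX j) (by positivity)

/-! ### The essential supremum norm -/

theorem ae_norm_le_supNorm {f : (Fin d → ℝ) → ℂ} (hf : Continuous f) :
    ∀ᵐ k ∂volume.restrict (box d), ‖f k‖ ≤ supNorm f := by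
  obtain ⟨B, hB⟩ := (isCompact_box d).exists_bound_of_continuousOn hf.continuousOn
  rw [supNorm, Measure.restrict_congr_set (torus_ae_eq_box d), eLpNorm_exponent_top]
  have hfin : eLpNormEssSup f (volume.restrict (box d)) ≠ ⊤ :=
    (eLpNormEssSup_lt_top_of_ae_bound (C := B)
      (ae_restrict_of_forall_mem (isCompact_box d).measurableSet hB)).ne
  filter_upwards [ae_le_eLpNormEssSup (f := f) (μ := volume.restrict (box d))] with k hk
  rw [← toReal_enorm]
  exact ENNReal.toReal_mono hfin hk

theorem finite_order_le (d N : ℕ) : Finite {β : Fin d → ℕ // order β ≤ N} := by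
  refine Set.Finite.to_subtype ((Set.finite_Iic fun _ : Fin d => N).subset fun β hβ j => ?_)
  exact (Finset.single_le_sum (fun i _ => Nat.zero_le (β i)) (Finset.mem_univ j)).trans hβ

theorem supNorm_nonneg (f : (Fin d → ℝ) → ℂ) : 0 ≤ supNorm f := ENNReal.toReal_nonneg

theorem derivSupNorm_nonneg (N : ℕ) (f : (Fin d → ℝ) → ℂ) : 0 ≤ derivSupNorm N f :=
  Real.iSup_nonneg fun _ => supNorm_nonneg _

theorem ae_norm_mderiv_le_derivSupNorm {N : ℕ} {f : (Fin d → ℝ) → ℂ} (hf : ContDiff ℝ N f) :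
    ∀ᵐ k ∂volume.restrict (box d), ∀ β, order β ≤ N → ‖mderiv β f k‖ ≤ derivSupNorm N f := by
  have := finite_order_le d N
  have h : ∀ᵐ k ∂volume.restrict (box d), ∀ β : {β : Fin d → ℕ // order β ≤ N},
      ‖mderiv β.1 f k‖ ≤ supNorm (mderiv β.1 f) := by
    refine ae_all_iff.2 fun β => ae_norm_le_supNorm ?_
    exact (contDiff_mderiv (m := 0) (hf.of_le (by norm_cast; simpa using β.2))).continuous
  filter_upwards [h] with k hk β hβ
  exact (hk ⟨β, hβ⟩).trans (le_ciSup (f := fun β : {β : Fin d → ℕ // order β ≤ N} =>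
    supNorm (mderiv β.1 f)) (Set.finite_range _).bddAbove ⟨β, hβ⟩)

/-! ### The oscillatory integral -/

/-- The estimate for a fixed sign of the time. In the sum over the number of derivatives falling on
the amplitude, the term without derivatives only sees `‖η‖_∞`; every other term carries a factor
`sin k_l`, worth an additional `t^{-1/2}`. -/
theorem exists_norm_integral_osc_mul_planeWave_le (hd : 1 ≤ d) {ω : ℝ} (hω : 0 < ω)
    {lam : Fin d → ℝ} (hlam : ∀ j, 0 < lam j) {σ : ℝ} (hσ : σ ^ 2 = 1) :
    ∃ C : ℝ, 0 ≤ C ∧ ∀ η : (Fin d → ℝ) → ℂ, ContDiff ℝ (d + 3 : ℕ) η → ∀ (x : Fin d → ℤ) (t : ℝ),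
      1 ≤ t → ‖∫ k in box d, osc ω lam σ t k * (planeWave x k * η k)‖ ≤
        C * (supNorm η / t ^ ((d : ℝ) / 2) + derivSupNorm (d + 3) η *
          ((3 + latticeNorm x) ^ (d + 3) / t ^ (((d : ℝ) + 1) / 2))) := by
  obtain ⟨A, hA, HA⟩ := exists_norm_integral_osc_le hd hω hlam hσ (d + 1) 0 (Coef.const 1)
  obtain ⟨W, hW, HW⟩ := exists_integral_weight_pow_le hlam
  obtain ⟨S, hS, HS⟩ := exists_weight_mul_abs_sin_le hlam
  choose B hB HB using exists_norm_sinDeriv_iterate_le d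
  have hsum : 0 ≤ ∑ j ∈ Finset.range (d + 1), B j * 2 ^ (j + 1) :=
    Finset.sum_nonneg fun j _ => mul_nonneg (hB j) (by positivity)
  refine ⟨A * (W + S * W * ∑ j ∈ Finset.range (d + 1), B j * 2 ^ (j + 1)), by positivity,
    fun η hη x t ht => ?_⟩
  have ht0 : 0 < t := zero_lt_one.trans_le ht
  have hw := (contDiff_weight hlam ht0.le).continuous
  have hw0 (k : Fin d → ℝ) := (weight_pos hlam ht0.le k).le
  have hwint : Integrable (fun k => weight lam t k ^ d) (volume.restrict (box d)) :=
    integrableOn_box (hw.pow d)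
  have hR := derivSupNorm_nonneg (d + 3) η
  have hx (j : Fin d) : |(x j : ℝ)| ≤ latticeNorm x :=
    Finset.single_le_sum (f := fun j => |(x j : ℝ)|) (fun j _ => abs_nonneg _) (Finset.mem_univ j)
  have hx0 : 0 ≤ latticeNorm x := Finset.sum_nonneg fun j _ => abs_nonneg _
  have hX : 1 ≤ 3 + latticeNorm x := by linarith
  have hb (n : ℕ) (hn : n ≤ d + 3) : ContDiff ℝ n fun k => planeWave x k * η k :=
    (contDiff_planeWave x).mul (hη.of_le (by exact_mod_cast hn))
  have main := HA t ht0.le _ (hb (d + 1) (by omega))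
  simp only [pow_zero, Complex.ofReal_one, one_mul, zero_add] at main
  have hzero : ∫ k in box d, weight lam t k ^ (d + 1) * ‖planeWave x k * η k‖ ≤
      W * (supNorm η / t ^ ((d : ℝ) / 2)) := by
    calc ∫ k in box d, weight lam t k ^ (d + 1) * ‖planeWave x k * η k‖
        ≤ ∫ k in box d, weight lam t k ^ d * supNorm η := by
          refine integral_mono_ae (integrableOn_box ((hw.pow _).mul (hb 0 (by omega)).continuous.norm))
            (hwint.mul_const _) ?_
          filter_upwards [ae_norm_le_supNorm hη.continuous] with k hk
          rw [norm_mul, norm_planeWave, one_mul]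
          exact mul_le_mul (pow_le_pow_of_le_one (hw0 k) (weight_le_one hlam ht0.le k)
            (Nat.le_succ d)) hk (norm_nonneg _) (pow_nonneg (hw0 k) _)
      _ ≤ W / t ^ ((d : ℝ) / 2) * supNorm η := by
          rw [integral_mul_const]
          exact mul_le_mul_of_nonneg_right (HW t ht0) (supNorm_nonneg η)
      _ = W * (supNorm η / t ^ ((d : ℝ) / 2)) := by ring
  have hsucc (j : ℕ) (hj : j < d + 1) :
      ∫ k in box d, weight lam t k ^ (d + 1) *
        ‖sinDeriv^[j + 1] (fun k => planeWave x k * η k) k‖ ≤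
      S * W * (B j * 2 ^ (j + 1)) * (derivSupNorm (d + 3) η *
          ((3 + latticeNorm x) ^ (d + 3) / t ^ (((d : ℝ) + 1) / 2))) := by
    have hcont : Continuous (sinDeriv^[j + 1] fun k => planeWave x k * η k) :=
      (contDiff_sinDeriv_iterate (m := 0) (j + 1)
        ((hb (0 + (j + 1)) (by omega)).of_le (by norm_cast))).continuous
    calc ∫ k in box d, weight lam t k ^ (d + 1) *
          ‖sinDeriv^[j + 1] (fun k => planeWave x k * η k) k‖
        ≤ ∫ k in box d, weight lam t k ^ d * (S / t ^ ((1 : ℝ) / 2) *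
            (B j * (2 ^ (j + 1) * ((3 + latticeNorm x) ^ (d + 3) * derivSupNorm (d + 3) η)))) := by
          refine integral_mono_ae (integrableOn_box ((hw.pow _).mul hcont.norm))
            (hwint.mul_const _) ?_
          filter_upwards [ae_norm_mderiv_le_derivSupNorm hη] with k hk
          have hη' : DerivBound (j + 1) (derivSupNorm (d + 3) η) η k := by
            have := derivBound_mderiv hη hk (j + 1) 0 (by simp [order]; omega)
            rwa [mderiv_zero] at this
          have hp := (derivBound_planeWave x hX (fun j => (hx j).trans (by linarith)) (j + 1) k).mono
            (pow_le_pow_right₀ hX (show j + 1 ≤ d + 3 by omega))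
          have h := HB j _ k _ (hb (j + 1) (by omega)) (hp.mul (contDiff_planeWave x)
            (hη.of_le (by norm_cast; omega)) hη')
          have hs := HS t ht0 k
          have hBj := hB j
          rw [pow_succ, mul_assoc]
          refine mul_le_mul_of_nonneg_left ?_ (pow_nonneg (hw0 k) _)
          refine (mul_le_mul_of_nonneg_left h (hw0 k)).trans ?_
          rw [← mul_assoc]
          exact mul_le_mul_of_nonneg_right hs (by positivity)
      _ ≤ W / t ^ ((d : ℝ) / 2) * (S / t ^ ((1 : ℝ) / 2) *
            (B j * (2 ^ (j + 1) * ((3 + latticeNorm x) ^ (d + 3) * derivSupNorm (d + 3) η)))) := by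
          rw [integral_mul_const]
          have hBj := hB j
          exact mul_le_mul_of_nonneg_right (HW t ht0) (by positivity)
      _ = _ := by
          rw [show ((d : ℝ) + 1) / 2 = (d : ℝ) / 2 + 1 / 2 by ring, Real.rpow_add ht0]
          field_simp
  refine main.trans ?_
  rw [mul_assoc A]
  refine mul_le_mul_of_nonneg_left ?_ hA
  rw [Finset.sum_range_succ' _ (d + 1)]
  have h1 := Finset.sum_le_sum fun j hj => hsucc j (Finset.mem_range.1 hj)
  rw [← Finset.sum_mul, ← Finset.mul_sum] at h1
  refine (add_le_add h1 hzero).trans ?_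
  have e1 : 0 ≤ supNorm η / t ^ ((d : ℝ) / 2) :=
    div_nonneg (supNorm_nonneg η) (Real.rpow_nonneg ht0.le _)
  have e2 : 0 ≤ derivSupNorm (d + 3) η *
      ((3 + latticeNorm x) ^ (d + 3) / t ^ (((d : ℝ) + 1) / 2)) := by positivity
  have e3 := mul_nonneg hW e2
  have e4 := mul_nonneg (mul_nonneg (mul_nonneg hS hW) hsum) e1
  linarith

theorem integral_phase_eq {ω : ℝ} {lam : Fin d → ℝ} {σ s t : ℝ} (h : σ * s = t)
    (x : Fin d → ℤ) (η : (Fin d → ℝ) → ℂ) :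
    ∫ k in torus d, Complex.exp (Complex.I * (phase ω lam t x k : ℂ)) * η k =
      ∫ k in box d, osc ω lam σ s k * (planeWave x k * η k) := by
  rw [setIntegral_congr_set (torus_ae_eq_box d)]
  congr 1
  funext k
  rw [← mul_assoc, osc, planeWave, ← Complex.exp_add, phase, ← h]
  congr 2
  push_cast
  ring

end HarmonicLattice

end

theorem theorem4p1 (d : ℕ) (hd : 1 ≤ d) (ω : ℝ) (hω : 0 < ω)
    (lam : Fin d → ℝ) (hlam : ∀ j, 0 < lam j) :
    ∃ C : ℝ, ∀ η : (Fin d → ℝ) → ℂ, HarmonicLattice.IsTorusCk (d + 3) η →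
      ∀ (x : Fin d → ℤ) (t : ℝ), 1 ≤ |t| →
        ‖∫ k in HarmonicLattice.torus d,
            Complex.exp (Complex.I * (HarmonicLattice.phase ω lam t x k : ℂ)) * η k‖ ≤
          C * (HarmonicLattice.supNorm η / |t| ^ ((d : ℝ) / 2) +
            HarmonicLattice.derivSupNorm (d + 3) η *
              ((3 + HarmonicLattice.latticeNorm x) ^ (d + 3) / |t| ^ (((d : ℝ) + 1) / 2))) := by
  obtain ⟨C₁, hC₁, H₁⟩ :=
    HarmonicLattice.exists_norm_integral_osc_mul_planeWave_le hd hω hlam (σ := 1) (by norm_num)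
  obtain ⟨C₂, hC₂, H₂⟩ :=
    HarmonicLattice.exists_norm_integral_osc_mul_planeWave_le hd hω hlam (σ := -1) (by norm_num)
  refine ⟨C₁ + C₂, fun η hη x t ht => ?_⟩
  have hη' : ContDiff ℝ (d + 3 : ℕ) η := by exact_mod_cast hη.1
  have hx : 0 ≤ HarmonicLattice.latticeNorm x := Finset.sum_nonneg fun j _ => abs_nonneg _
  have hR := HarmonicLattice.derivSupNorm_nonneg (d + 3) η
  have hR₀ := HarmonicLattice.supNorm_nonneg η
  have hnn : 0 ≤ HarmonicLattice.supNorm η / |t| ^ ((d : ℝ) / 2) +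
      HarmonicLattice.derivSupNorm (d + 3) η *
        ((3 + HarmonicLattice.latticeNorm x) ^ (d + 3) / |t| ^ (((d : ℝ) + 1) / 2)) := by
    positivity
  rw [add_mul]
  rcases abs_choice t with h | h
  · rw [HarmonicLattice.integral_phase_eq (σ := 1) (s := |t|) (by rw [h, one_mul])]
    exact (H₁ η hη' x |t| ht).trans (le_add_of_nonneg_right (mul_nonneg hC₂ hnn))
  · rw [HarmonicLattice.integral_phase_eq (σ := -1) (s := |t|) (by rw [h]; ring)]
    exact (H₂ η hη' x |t| ht).trans (le_add_of_nonneg_left (mul_nonneg hC₁ hnn))
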